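/- Let $M$ be a smooth manifold and let $((A,\mu),(A^*,\gamma))$ be a Lie bialgebroid over $M$: $A\to M$ is a smooth real vector bundle of finite rank, $\mu$ and $\gamma$ are Lie algebroid structures on $A$ and on $A^*$ (with brackets $[\,,]^\mu$, $[\,,]^\gamma$, Lie derivatives $\mathcal L^\mu$, $\mathcal L^\gamma$ and differentials $\mathrm d_\mu$, $\mathrm d_\gamma$), and $\mathrm d_\gamma$ is a derivation of the Schouten bracket of $\mu$. Its double is the Courant algebroid $E=A\oplus A^*$ with the bilinear form $\langle X+\xi,Y+\eta\rangle=\xi(Y)+\eta(X)$ and the Dorfman bracket determined, for $X,Y\in\Gamma(A)$ and $\xi,\eta\in\Gamma(A^*)$, by bi-additivity and $$[X,Y]=[X,Y]^\mu,\quad [X,\eta]=-i_\eta \mathrm d_\gamma X+\mathcal L^\mu_X\eta,\quad [\xi,Y]=\mathcal L^\gamma_\xi Y-i_Y\mathrm d_\mu\xi,\quad [\xi,\eta]=[\xi,\eta]^\gamma .$$ Assume that $E$ is irreducible, i.e. every vector bundle endomorphism $\phi$ of $E$ that is symmetric for $\langle\,,\rangle$ and satisfies $[u,\phi v]=\phi[u,v]$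 and $[\phi u,v]=\phi[u,v]$ for all sections $u,v$ of $E$ is a constant real multiple of $\mathrm{Id}_E$. For an endomorphism $N$ of a vector bundle whose sections carry a bracket, the torsion of $N$ is $T_N(u,v)=[Nu,Nv]-N([Nu,v]+[u,Nv]-N[u,v])$. A Nijenhuis tensor on $E$ is an endomorphism, skew-symmetric for $\langle\,,\rangle$, with vanishing torsion. A cps structure on a Lie algebroid $B$ is an endomorphism $J$ of $B$ with vanishing torsion such that $J^2=\epsilon\,\mathrm{Id}_B$, where $\epsilon\in\{-1,1,0\}$. Let $N$ be a vector bundle endomorphism of $A$, with transpose ${}^tN:A^*\to A^*$. If $\mathcal N=\begin{pmatrix}N&0\\0&-{}^tN\end{pmatrix}$ is a Nijenhuis tensor on $E$, then $N$ is a constant real multiple of a cps structure on $(A,\mu)$, and ${}^tN$ is a constant real multiple of a cps structure on $(A^*,\gamma)$. -/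

import Mathlib

open Bundle Topology Filter
open scoped Manifold ContDiff

set_option linter.unusedSectionVars false

noncomputable section

namespace LieBialg

section Basic

variable (n : ℕ) (M : Type*) [TopologicalSpace M] [ChartedSpace (EuclideanSpace ℝ (Fin n)) M]

/-- The ring `C^∞(M)` of smooth real functions on an `n`-dimensional manifold `M`. -/
abbrev SmoothFun : Type _ := C^∞⟮𝓡 n, M; 𝓘(ℝ, ℝ), ℝ⟯

variable {M} (F : Type*) [NormedAddCommGroup F] [NormedSpace ℝ F]
  (V : M → Type*) [TopologicalSpace (TotalSpace F V)] [∀ x, TopologicalSpace (V x)]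
  [FiberBundle F V]

/-- The space `Γ(V)` of smooth global sections of a bundle `V` over `M` with typical fibre `F`. -/
abbrev Sec : Type _ := ContMDiffSection (𝓡 n) F ∞ V

variable [∀ x, AddCommGroup (V x)] [∀ x, Module ℝ (V x)]

/-- The dual bundle `V*`, as a bundle of (continuous) linear forms. -/
abbrev Dual : M → Type _ := fun x => V x →L[ℝ] Bundle.Trivial M ℝ x

variable {V} in
/-- Evaluation of a linear form on a fibre of `V`, as a real number. -/
def ev {x : M} (ξ : Dual V x) (v : V x) : ℝ := ξ v

section ev
variable {V} {x : M}
theorem ev_add (ξ : Dual V x) (v w : V x) : ev ξ (v + w) = ev ξ v + ev ξ w := map_add ξ v w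
theorem ev_neg (ξ : Dual V x) (v : V x) : ev ξ (-v) = - ev ξ v := map_neg ξ v
theorem ev_smul (ξ : Dual V x) (c : ℝ) (v : V x) : ev ξ (c • v) = c * ev ξ v := map_smul ξ c v
theorem add_ev (ξ η : Dual V x) (v : V x) : ev (ξ + η) v = ev ξ v + ev η v := rfl
theorem neg_ev (ξ : Dual V x) (v : V x) : ev (-ξ) v = - ev ξ v := rfl
theorem smul_ev (c : ℝ) (ξ : Dual V x) (v : V x) : ev (c • ξ) v = c * ev ξ v := rfl
theorem ev_zero (ξ : Dual V x) : ev ξ 0 = 0 := map_zero ξ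
theorem zero_ev (v : V x) : ev (0 : Dual V x) v = 0 := rfl
theorem ev_sum {ι : Type*} (s : Finset ι) (ξ : Dual V x) (v : ι → V x) :
    ev ξ (∑ i ∈ s, v i) = ∑ i ∈ s, ev ξ (v i) := map_sum ξ v s
theorem sum_ev {ι : Type*} (s : Finset ι) (ξ : ι → Dual V x) (v : V x) :
    ev (∑ i ∈ s, ξ i) v = ∑ i ∈ s, ev (ξ i) v := by
  classical
  induction s using Finset.induction_on with
  | empty => simp [zero_ev]
  | insert a s ha ih => rw [Finset.sum_insert ha, Finset.sum_insert ha, add_ev, ih]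
theorem ev_ext {ξ η : Dual V x} (h : ∀ v, ev ξ v = ev η v) : ξ = η := ContinuousLinearMap.ext h
end ev

variable {n F V}
variable [VectorBundle ℝ F V]

instance : SMul (SmoothFun n M) (Sec n F V) where
  smul f s := ⟨fun x => f x • s x, f.contMDiff.smul_section s.contMDiff⟩

theorem smul_apply (f : SmoothFun n M) (s : Sec n F V) (x : M) : (f • s) x = f x • s x := rfl

instance : Module (SmoothFun n M) (Sec n F V) where
  one_smul s := by ext x; simp [smul_apply]
  mul_smul f g s := by ext x; simp [smul_apply, mul_smul]
  smul_zero f := by ext x; simp [smul_apply]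
  smul_add f s t := by ext x; simp [smul_apply]
  add_smul f g s := by ext x; simp [smul_apply, add_smul]
  zero_smul s := by ext x; simp [smul_apply]


/-- The duality pairing `⟨ξ, X⟩ ∈ C^∞(M)` of sections `ξ` of `V*` and `X` of `V`. -/
def pair (ξ : Sec n (F →L[ℝ] ℝ) (Dual V)) (X : Sec n F V) : SmoothFun n M :=
  ⟨fun x => ev (ξ x) (X x), fun x =>
    (contMDiffAt_section x).1 ((ξ.contMDiff.clm_bundle_apply X.contMDiff) x)⟩

theorem pair_apply (ξ : Sec n (F →L[ℝ] ℝ) (Dual V)) (X : Sec n F V) (x : M) :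
    pair ξ X x = ev (ξ x) (X x) := rfl

theorem sec_sum_apply {ι : Type*} (s : Finset ι) (X : ι → Sec n F V) (x : M) :
    (∑ i ∈ s, X i) x = ∑ i ∈ s, X i x := by
  have := congrFun (map_sum (ContMDiffSection.coeAddHom (𝓡 n) F ∞ V) X s) x
  rw [Finset.sum_apply] at this
  exact this

variable [FiniteDimensional ℝ F] [ContMDiffVectorBundle ∞ F V (𝓡 n)]
  [IsManifold (𝓡 n) ∞ M] [T2Space M]

/-- Near any point, a smooth vector bundle has a frame and a dual frame which are the restrictions
of global smooth sections. -/
theorem exists_local_frame (x₀ : M) :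
    ∃ (k : ℕ) (E : Fin k → Sec n F V) (θ : Fin k → Sec n (F →L[ℝ] ℝ) (Dual V))
      (h : SmoothFun n M), (∀ᶠ x in 𝓝 x₀, h x = 1) ∧
      ∀ (x : M) (v : V x), h x • v = ∑ i, ev (θ i x) v • E i x := by
  let e := trivializationAt F V x₀
  let b := Module.finBasis ℝ F
  have hx₀ : x₀ ∈ e.baseSet := mem_baseSet_trivializationAt F V x₀
  obtain ⟨χ, -, hχ⟩ := (SmoothBumpFunction.nhds_basis_tsupport (I := 𝓡 n) x₀).mem_iff.1
    (e.open_baseSet.mem_nhds hx₀)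
  let E : Fin (Module.finrank ℝ F) → Sec n F V := fun i =>
    ⟨fun x => χ x • e.symm x (b i), by
      refine ContMDiffOn.smul_section_of_tsupport (u := e.baseSet) χ.contMDiff.contMDiffOn
        e.open_baseSet hχ ?_
      rw [e.contMDiffOn_section_baseSet_iff]
      refine (contMDiffOn_const (c := b i)).congr ?_
      intro y hy
      simp [hy]⟩
  let θ : Fin (Module.finrank ℝ F) → Sec n (F →L[ℝ] ℝ) (Dual V) := fun i =>
    ⟨fun x => χ x • ((LinearMap.toContinuousLinearMap (b.coord i)).comp
        (e.continuousLinearMapAt ℝ x) : V x →L[ℝ] ℝ), by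
      refine ContMDiffOn.smul_section_of_tsupport (u := e.baseSet) χ.contMDiff.contMDiffOn
        e.open_baseSet hχ ?_
      let e' := trivializationAt (F →L[ℝ] ℝ) (Dual V) x₀
      have hb : e'.baseSet = e.baseSet := by
        rw [hom_trivializationAt_baseSet]
        exact Set.inter_univ _
      rw [← hb, e'.contMDiffOn_section_baseSet_iff]
      refine (contMDiffOn_const (c := LinearMap.toContinuousLinearMap (b.coord i))).congr ?_
      intro y hy
      rw [hb] at hy
      rw [hom_trivializationAt_apply]
      ext w
      have h1 : e.continuousLinearMapAt ℝ y (e.symmL ℝ y w) = w :=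
        e.continuousLinearMapAt_symmL hy w
      simp [ContinuousLinearMap.inCoordinates]
      change b.repr (e.continuousLinearMapAt ℝ y (e.symmL ℝ y w)) i = _
      rw [h1]⟩
  refine ⟨_, E, θ, ⟨fun x => χ x * χ x, χ.contMDiff.mul χ.contMDiff⟩, ?_, ?_⟩
  · filter_upwards [χ.eventuallyEq_one] with x hx
    change χ x * χ x = 1
    rw [hx]; simp
  · intro x v
    by_cases hx : x ∈ e.baseSet
    · have h1 : v = ∑ i, b.repr (e.continuousLinearMapAt ℝ x v) i • e.symm x (b i) := by
        have h2 := b.sum_repr (e.continuousLinearMapAt ℝ x v)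
        have h3 := congrArg (e.symmL ℝ x) h2
        rw [e.symmL_continuousLinearMapAt hx] at h3
        simp only [map_sum, map_smul] at h3
        simpa only [e.symmL_apply hx] using h3.symm
      conv_lhs => rw [h1]
      change (χ x * χ x) • _ = _
      rw [Finset.smul_sum]
      refine Finset.sum_congr rfl fun i _ => ?_
      have h4 : ev (θ i x) v = χ x * b.repr (e.continuousLinearMapAt ℝ x v) i := rfl
      have h5 : E i x = χ x • e.symm x (b i) := rfl
      rw [h4, h5, smul_smul, smul_smul]
      congr 1
      change _ = (χ x * _) * _
      ring
    · have : χ x = 0 := image_eq_zero_of_notMem_tsupport (fun h => hx (hχ h))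
      simp [E, this]

theorem exists_sec_eq (x₀ : M) (v : V x₀) : ∃ X : Sec n F V, X x₀ = v := by
  obtain ⟨k, E, θ, h, h1, hE⟩ := exists_local_frame (n := n) (F := F) (V := V) x₀
  refine ⟨∑ i, ev (θ i x₀) v • E i, ?_⟩
  rw [sec_sum_apply]
  have := hE x₀ v
  rw [h1.self_of_nhds, one_smul] at this
  exact this.symm

theorem exists_dual_sec_eq (x₀ : M) (ξ : Dual V x₀) :
    ∃ α : Sec n (F →L[ℝ] ℝ) (Dual V), α x₀ = ξ := by
  obtain ⟨k, E, θ, h, h1, hE⟩ := exists_local_frame (n := n) (F := F) (V := V) x₀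
  refine ⟨∑ i, ev ξ (E i x₀) • θ i, ?_⟩
  rw [sec_sum_apply]
  refine ev_ext fun v => ?_
  have := hE x₀ v
  rw [h1.self_of_nhds, one_smul] at this
  conv_rhs => rw [this]
  rw [ev_sum, sum_ev]
  refine Finset.sum_congr rfl fun i _ => ?_
  rw [ev_smul]
  exact (smul_ev _ _ _).trans (mul_comm _ _)

/-- The dual form of the local frame expansion: `h ξ = ∑ ⟨ξ, Eᵢ⟩ θᵢ`. -/
theorem dual_expand {k : ℕ} {E : Fin k → Sec n F V} {θ : Fin k → Sec n (F →L[ℝ] ℝ) (Dual V)}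
    {h : SmoothFun n M} (hE : ∀ (x : M) (v : V x), h x • v = ∑ i, ev (θ i x) v • E i x)
    (x : M) (ξ : Dual V x) : h x • ξ = ∑ i, ev ξ (E i x) • θ i x := by
  refine ev_ext fun v => ?_
  rw [smul_ev, ← ev_smul, hE, ev_sum, sum_ev]
  refine Finset.sum_congr rfl fun i _ => ?_
  rw [ev_smul]
  exact ((smul_ev _ _ _).trans (mul_comm _ _)).symm

/-- A family of vectors `s x ∈ V x` is a smooth section as soon as its pairings with all smooth
sections of the dual bundle are smooth. -/
theorem smooth_of_pair (s : ∀ x, V x) (hs : ∀ ξ : Sec n (F →L[ℝ] ℝ) (Dual V),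
      ContMDiff (𝓡 n) 𝓘(ℝ, ℝ) ∞ (fun x => ev (ξ x) (s x))) :
    ContMDiff (𝓡 n) ((𝓡 n).prod 𝓘(ℝ, F)) ∞ (fun x => TotalSpace.mk' F x (s x)) := by
  intro x₀
  obtain ⟨k, E, θ, h, h1, hE⟩ := exists_local_frame (n := n) (F := F) (V := V) x₀
  have h2 : ContMDiffAt (𝓡 n) ((𝓡 n).prod 𝓘(ℝ, F)) ∞ (fun x => TotalSpace.mk' F x
      (∑ i, ev (θ i x) (s x) • E i x)) x₀ :=
    ContMDiffAt.sum_section fun i _ => ContMDiffAt.smul_section (hs (θ i) x₀) ((E i).contMDiff x₀)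
  refine h2.congr_of_eventuallyEq ?_
  filter_upwards [h1] with x hx
  rw [← hE, hx, one_smul]

/-- A family of linear forms is a smooth section of the dual bundle as soon as its pairings with
all smooth sections are smooth. -/
theorem dual_smooth_of_pair (s : ∀ x, Dual V x) (hs : ∀ X : Sec n F V,
      ContMDiff (𝓡 n) 𝓘(ℝ, ℝ) ∞ (fun x => ev (s x) (X x))) :
    ContMDiff (𝓡 n) ((𝓡 n).prod 𝓘(ℝ, F →L[ℝ] ℝ)) ∞
      (fun x => TotalSpace.mk' (F →L[ℝ] ℝ) (E := Dual V) x (s x)) := by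
  intro x₀
  obtain ⟨k, E, θ, h, h1, hE⟩ := exists_local_frame (n := n) (F := F) (V := V) x₀
  have h2 : ContMDiffAt (𝓡 n) ((𝓡 n).prod 𝓘(ℝ, F →L[ℝ] ℝ)) ∞ (fun x =>
      TotalSpace.mk' (F →L[ℝ] ℝ) (E := Dual V) x (∑ i, ev (s x) (E i x) • θ i x)) x₀ :=
    ContMDiffAt.sum_section fun i _ => ContMDiffAt.smul_section (hs (E i) x₀) ((θ i).contMDiff x₀)
  refine h2.congr_of_eventuallyEq ?_
  filter_upwards [h1] with x hx
  rw [← dual_expand hE, hx, one_smul]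

/-- A `C^∞(M)`-linear functional on `Γ(V)` is given by a unique smooth section of `V*`. -/
theorem existsUnique_dual_of_functional (Φ : Sec n F V →ₗ[SmoothFun n M] SmoothFun n M) :
    ∃! ξ : Sec n (F →L[ℝ] ℝ) (Dual V), ∀ X, pair ξ X = Φ X := by
  have key : ∀ x₀ : M, ∃ ξ : Dual V x₀, ∀ X, ev ξ (X x₀) = Φ X x₀ := by
    intro x₀
    obtain ⟨k, E, θ, h, h1, hE⟩ := exists_local_frame (n := n) (F := F) (V := V) x₀
    refine ⟨∑ i, Φ (E i) x₀ • θ i x₀, fun X => ?_⟩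
    have h2 : h • X = ∑ i, pair (θ i) X • E i := by
      ext x
      rw [sec_sum_apply]
      exact hE x (X x)
    have h3 := congrArg (fun f : SmoothFun n M => f x₀) (congrArg Φ h2)
    simp only [map_smul, map_sum] at h3
    have h4 : (h • Φ X) x₀ = Φ X x₀ := by
      change h x₀ * Φ X x₀ = _
      rw [h1.self_of_nhds, one_mul]
    rw [h4] at h3
    have h5 : (∑ i, pair (θ i) X • Φ (E i)) x₀ = ∑ i, ev (θ i x₀) (X x₀) * Φ (E i) x₀ := by
      have := congrFun (map_sum (ContMDiffMap.coeFnAddMonoidHom (I := 𝓡 n) (N := M)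
        (I' := 𝓘(ℝ, ℝ)) (G := ℝ) (n := ∞)) (fun i => pair (θ i) X • Φ (E i)) Finset.univ) x₀
      rw [Finset.sum_apply] at this
      exact this
    rw [h3, h5, sum_ev]
    refine Finset.sum_congr rfl fun i _ => ?_
    rw [mul_comm]
    exact smul_ev _ _ _
  choose ξ hξ using key
  refine ⟨⟨ξ, dual_smooth_of_pair ξ fun X => ?_⟩, fun X => ?_, fun η hη => ?_⟩
  · simp_rw [hξ]
    exact (Φ X).contMDiff
  · ext x
    exact hξ x X
  · ext x : 1
    refine ev_ext fun v => ?_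
    obtain ⟨X, rfl⟩ := exists_sec_eq (n := n) (F := F) x v
    rw [← pair_apply, hη]
    exact (hξ x X).symm

/-- A `C^∞(M)`-linear functional on `Γ(V*)` is given by a unique smooth section of `V`. -/
theorem existsUnique_sec_of_functional
    (Φ : Sec n (F →L[ℝ] ℝ) (Dual V) →ₗ[SmoothFun n M] SmoothFun n M) :
    ∃! X : Sec n F V, ∀ ξ, pair ξ X = Φ ξ := by
  have key : ∀ x₀ : M, ∃ v : V x₀, ∀ ξ : Sec n (F →L[ℝ] ℝ) (Dual V), ev (ξ x₀) v = Φ ξ x₀ := by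
    intro x₀
    obtain ⟨k, E, θ, h, h1, hE⟩ := exists_local_frame (n := n) (F := F) (V := V) x₀
    refine ⟨∑ i, Φ (θ i) x₀ • E i x₀, fun ξ => ?_⟩
    have h2 : h • ξ = ∑ i, pair ξ (E i) • θ i := by
      ext x : 1
      rw [sec_sum_apply]
      exact dual_expand hE x (ξ x)
    have h3 := congrArg (fun f : SmoothFun n M => f x₀) (congrArg Φ h2)
    simp only [map_smul, map_sum] at h3
    have h4 : (h • Φ ξ) x₀ = Φ ξ x₀ := by
      change h x₀ * Φ ξ x₀ = _
      rw [h1.self_of_nhds, one_mul]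
    rw [h4] at h3
    have h5 : (∑ i, pair ξ (E i) • Φ (θ i)) x₀ = ∑ i, ev (ξ x₀) (E i x₀) * Φ (θ i) x₀ := by
      have := congrFun (map_sum (ContMDiffMap.coeFnAddMonoidHom (I := 𝓡 n) (N := M)
        (I' := 𝓘(ℝ, ℝ)) (G := ℝ) (n := ∞)) (fun i => pair ξ (E i) • Φ (θ i)) Finset.univ) x₀
      rw [Finset.sum_apply] at this
      exact this
    rw [h3, h5, ev_sum]
    refine Finset.sum_congr rfl fun i _ => ?_
    rw [mul_comm, ev_smul]
  choose s hs using key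
  refine ⟨⟨s, smooth_of_pair s fun ξ => ?_⟩, fun ξ => ?_, fun Y hY => ?_⟩
  · simp_rw [hs]
    exact (Φ ξ).contMDiff
  · ext x
    exact hs x ξ
  · ext x : 1
    obtain ⟨k, E, θ, h, h1, hE⟩ := exists_local_frame (n := n) (F := F) (V := V) x
    have e1 := hE x (Y x)
    have e2 := hE x (s x)
    rw [h1.self_of_nhds, one_smul] at e1 e2
    rw [e1]
    refine Eq.trans ?_ e2.symm
    refine Finset.sum_congr rfl fun i _ => ?_
    rw [hs, ← pair_apply, hY]

/-- The section of `V*` representing a `C^∞(M)`-linear functional on `Γ(V)`. -/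
def toDual (Φ : Sec n F V →ₗ[SmoothFun n M] SmoothFun n M) : Sec n (F →L[ℝ] ℝ) (Dual V) :=
  (existsUnique_dual_of_functional Φ).choose

theorem pair_toDual (Φ : Sec n F V →ₗ[SmoothFun n M] SmoothFun n M) (X : Sec n F V) :
    pair (toDual Φ) X = Φ X := (existsUnique_dual_of_functional Φ).choose_spec.1 X

/-- The section of `V` representing a `C^∞(M)`-linear functional on `Γ(V*)`. -/
def toSec (Φ : Sec n (F →L[ℝ] ℝ) (Dual V) →ₗ[SmoothFun n M] SmoothFun n M) : Sec n F V :=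
  (existsUnique_sec_of_functional Φ).choose

theorem pair_toSec (Φ : Sec n (F →L[ℝ] ℝ) (Dual V) →ₗ[SmoothFun n M] SmoothFun n M)
    (ξ : Sec n (F →L[ℝ] ℝ) (Dual V)) : pair ξ (toSec Φ) = Φ ξ :=
  (existsUnique_sec_of_functional Φ).choose_spec.1 ξ

theorem pair_add_right (ξ : Sec n (F →L[ℝ] ℝ) (Dual V)) (X Y : Sec n F V) :
    pair ξ (X + Y) = pair ξ X + pair ξ Y := by ext x; exact ev_add _ _ _
theorem pair_add_left (ξ η : Sec n (F →L[ℝ] ℝ) (Dual V)) (X : Sec n F V) :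
    pair (ξ + η) X = pair ξ X + pair η X := by ext x; exact add_ev _ _ _
theorem pair_smul_right (ξ : Sec n (F →L[ℝ] ℝ) (Dual V)) (f : SmoothFun n M) (X : Sec n F V) :
    pair ξ (f • X) = f * pair ξ X := by ext x; exact ev_smul _ _ _
theorem pair_smul_left (ξ : Sec n (F →L[ℝ] ℝ) (Dual V)) (f : SmoothFun n M) (X : Sec n F V) :
    pair (f • ξ) X = f * pair ξ X := by ext x; exact smul_ev _ _ _

end Basic

section Hom

variable (n : ℕ) {M : Type*} [TopologicalSpace M] [ChartedSpace (EuclideanSpace ℝ (Fin n)) M]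
  (F₁ : Type*) [NormedAddCommGroup F₁] [NormedSpace ℝ F₁]
  (V₁ : M → Type*) [TopologicalSpace (TotalSpace F₁ V₁)] [∀ x, TopologicalSpace (V₁ x)]
  [FiberBundle F₁ V₁] [∀ x, AddCommGroup (V₁ x)] [∀ x, Module ℝ (V₁ x)]
  (F₂ : Type*) [NormedAddCommGroup F₂] [NormedSpace ℝ F₂]
  (V₂ : M → Type*) [TopologicalSpace (TotalSpace F₂ V₂)] [∀ x, TopologicalSpace (V₂ x)]
  [FiberBundle F₂ V₂] [∀ x, AddCommGroup (V₂ x)] [∀ x, Module ℝ (V₂ x)]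

/-- A smooth vector bundle morphism `V₁ → V₂` over the identity of `M`. -/
structure BundleHom where
  toFun : ∀ x, V₁ x →L[ℝ] V₂ x
  smooth : ContMDiff ((𝓡 n).prod 𝓘(ℝ, F₁)) ((𝓡 n).prod 𝓘(ℝ, F₂)) ∞
    (fun p : TotalSpace F₁ V₁ => TotalSpace.mk' F₂ p.1 (toFun p.1 p.2))

/-- Smooth vector bundle endomorphisms of `V₁`. -/
abbrev BundleEnd := BundleHom n F₁ V₁ F₁ V₁

variable {n F₁ V₁ F₂ V₂}

/-- The map on sections induced by a vector bundle morphism. -/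
def BundleHom.map (φ : BundleHom n F₁ V₁ F₂ V₂) (X : Sec n F₁ V₁) : Sec n F₂ V₂ :=
  ⟨fun x => φ.toFun x (X x), φ.smooth.comp X.contMDiff⟩

theorem BundleHom.map_apply (φ : BundleHom n F₁ V₁ F₂ V₂) (X : Sec n F₁ V₁) (x : M) :
    φ.map X x = φ.toFun x (X x) := rfl

variable [VectorBundle ℝ F₁ V₁] [VectorBundle ℝ F₂ V₂] [FiniteDimensional ℝ F₁]
  [ContMDiffVectorBundle ∞ F₁ V₁ (𝓡 n)] [IsManifold (𝓡 n) ∞ M] [T2Space M]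
  [ContMDiffVectorBundle ∞ F₂ V₂ (𝓡 n)]

/-- A family of linear maps which maps smooth sections to smooth sections is smooth. -/
theorem smooth_of_sections (φ : ∀ x, V₁ x →L[ℝ] V₂ x)
    (hφ : ∀ X : Sec n F₁ V₁, ContMDiff (𝓡 n) ((𝓡 n).prod 𝓘(ℝ, F₂)) ∞
      (fun x => TotalSpace.mk' F₂ x (φ x (X x)))) :
    ContMDiff ((𝓡 n).prod 𝓘(ℝ, F₁)) ((𝓡 n).prod 𝓘(ℝ, F₂)) ∞
      (fun p : TotalSpace F₁ V₁ => TotalSpace.mk' F₂ p.1 (φ p.1 p.2)) := by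
  intro p₀
  obtain ⟨k, E, θ, h, h1, hE⟩ := exists_local_frame (n := n) (F := F₁) (V := V₁) p₀.1
  let e := trivializationAt F₂ V₂ p₀.1
  have he : p₀.1 ∈ e.baseSet := mem_baseSet_trivializationAt F₂ V₂ p₀.1
  have hp : ContMDiff ((𝓡 n).prod 𝓘(ℝ, F₁)) (𝓡 n) ∞ (fun p : TotalSpace F₁ V₁ => p.1) :=
    contMDiff_proj V₁
  rw [contMDiffAt_totalSpace]
  refine ⟨hp p₀, ?_⟩
  have h2 : ContMDiffAt ((𝓡 n).prod 𝓘(ℝ, F₁)) 𝓘(ℝ, F₂) ∞ (fun p : TotalSpace F₁ V₁ =>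
      ∑ i, ev (θ i p.1) p.2 • (e ⟨p.1, φ p.1 (E i p.1)⟩).2) p₀ := by
    refine ContMDiffAt.sum fun i _ => ?_
    have h3 : ContMDiffAt ((𝓡 n).prod 𝓘(ℝ, F₁)) 𝓘(ℝ, ℝ) ∞
        (fun p : TotalSpace F₁ V₁ => ev (θ i p.1) p.2) p₀ := by
      have h3 := ((θ i).contMDiff.comp hp).clm_bundle_apply (v := fun p : TotalSpace F₁ V₁ => p.2)
        contMDiff_id
      exact (contMDiffAt_totalSpace.1 (h3 p₀)).2
    have h4 : ContMDiffAt ((𝓡 n).prod 𝓘(ℝ, F₁)) 𝓘(ℝ, F₂) ∞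
        (fun p : TotalSpace F₁ V₁ => (e ⟨p.1, φ p.1 (E i p.1)⟩).2) p₀ :=
      ((contMDiffAt_section p₀.1).1 (hφ (E i) p₀.1)).comp p₀ (hp p₀)
    exact h3.smul h4
  refine h2.congr_of_eventuallyEq ?_
  have hc : Continuous (fun p : TotalSpace F₁ V₁ => p.1) := hp.continuous
  filter_upwards [hc.continuousAt.eventually h1, hc.continuousAt.eventually
    (e.open_baseSet.mem_nhds he)] with p hp1 hp2
  have h4 : p.2 = ∑ i, ev (θ i p.1) p.2 • E i p.1 := by rw [← hE, hp1, one_smul]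
  have h5 : ∀ v, (e ⟨p.1, v⟩).2 = e.continuousLinearMapAt ℝ p.1 v := fun v =>
    (congrFun (e.coe_linearMapAt_of_mem (R := ℝ) hp2) v).symm
  change (e ⟨p.1, φ p.1 p.2⟩).2 = _
  simp_rw [h5]
  conv_lhs => rw [h4]
  simp only [map_sum, map_smul]

/-- The transpose of a linear map of the fibre at `x`. -/
def fibreTranspose {x : M} (N : V₁ x →L[ℝ] V₁ x) : Dual V₁ x →L[ℝ] Dual V₁ x :=
  ContinuousLinearMap.precomp (Bundle.Trivial M ℝ x) N

theorem ev_fibreTranspose {x : M} (N : V₁ x →L[ℝ] V₁ x) (ξ : Dual V₁ x) (v : V₁ x) :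
    ev (fibreTranspose N ξ) v = ev ξ (N v) := rfl

/-- The transpose `ᵗN : V* → V*` of an endomorphism `N` of `V`, `ξ ↦ ξ ∘ N`. -/
def BundleHom.transpose (N : BundleEnd n F₁ V₁) :
    BundleEnd n (F₁ →L[ℝ] ℝ) (Dual V₁) where
  toFun x := fibreTranspose (N.toFun x)
  smooth := smooth_of_sections (fun x => fibreTranspose (N.toFun x)) fun ξ =>
    dual_smooth_of_pair (fun x => fibreTranspose (N.toFun x) (ξ x)) fun X =>
    (pair ξ (N.map X)).contMDiff

theorem BundleHom.ev_transpose (N : BundleEnd n F₁ V₁) (x : M) (ξ : Dual V₁ x) (v : V₁ x) :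
    ev (N.transpose.toFun x ξ) v = ev ξ (N.toFun x v) := rfl

end Hom

section Double

variable {n : ℕ} {M : Type*} [TopologicalSpace M] [ChartedSpace (EuclideanSpace ℝ (Fin n)) M]
  {F : Type*} [NormedAddCommGroup F] [NormedSpace ℝ F]
  {V : M → Type*} [TopologicalSpace (TotalSpace F V)] [∀ x, TopologicalSpace (V x)]
  [FiberBundle F V] [∀ x, AddCommGroup (V x)] [∀ x, Module ℝ (V x)] [VectorBundle ℝ F V]

/-- The section `(X, ξ)` of `V ⊕ V*` with components `X` and `ξ`. -/
def mkSec (X : Sec n F V) (ξ : Sec n (F →L[ℝ] ℝ) (Dual V)) :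
    Sec n (F × (F →L[ℝ] ℝ)) (V ×ᵇ Dual V) :=
  ⟨fun x => (X x, ξ x), fun x => (contMDiffAt_section x).2
    (((contMDiffAt_section x).1 (X.contMDiff x)).prodMk_space
      ((contMDiffAt_section x).1 (ξ.contMDiff x)))⟩

/-- The component in `Γ(V)` of a section of `V ⊕ V*`. -/
def vecPart (u : Sec n (F × (F →L[ℝ] ℝ)) (V ×ᵇ Dual V)) : Sec n F V :=
  ⟨fun x => (u x).1, fun x => (contMDiffAt_section x).2
    ((ContinuousLinearMap.fst ℝ F (F →L[ℝ] ℝ)).contMDiff.contMDiffAt.comp x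
      ((contMDiffAt_section x).1 (u.contMDiff x)))⟩

/-- The component in `Γ(V*)` of a section of `V ⊕ V*`. -/
def formPart (u : Sec n (F × (F →L[ℝ] ℝ)) (V ×ᵇ Dual V)) : Sec n (F →L[ℝ] ℝ) (Dual V) :=
  ⟨fun x => (u x).2, fun x => (contMDiffAt_section x).2
    ((ContinuousLinearMap.snd ℝ F (F →L[ℝ] ℝ)).contMDiff.contMDiffAt.comp x
      ((contMDiffAt_section x).1 (u.contMDiff x)))⟩

end Double

section LieAlgebroid

variable (n : ℕ) {M : Type*} [TopologicalSpace M] [ChartedSpace (EuclideanSpace ℝ (Fin n)) M]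
  (F : Type*) [NormedAddCommGroup F] [NormedSpace ℝ F]
  (V : M → Type*) [TopologicalSpace (TotalSpace F V)] [∀ x, TopologicalSpace (V x)]
  [FiberBundle F V] [∀ x, AddCommGroup (V x)] [∀ x, Module ℝ (V x)]
  [IsManifold (𝓡 n) ∞ M]

/-- Vector bundle morphisms `V → TM`. -/
abbrev AnchorMap := BundleHom n F V (EuclideanSpace ℝ (Fin n))
  (fun x : M => TangentSpace (𝓡 n) x)

variable {n F V}

/-- The derivative `ρ(X) · f` of a function along the vector field `ρ(X)`. -/
def AnchorMap.act (ρ : AnchorMap n F V) (X : Sec n F V) (f : SmoothFun n M) : SmoothFun n M :=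
  ⟨fun x => mfderiv (𝓡 n) 𝓘(ℝ, ℝ) f x (ρ.toFun x (X x)), by
    have h1 := (f.contMDiff.contMDiff_tangentMap (m := ∞) (by simp)).comp (ρ.map X).contMDiff
    exact (contMDiff_snd_tangentBundle_modelSpace ℝ 𝓘(ℝ, ℝ)).comp h1⟩

theorem AnchorMap.act_apply (ρ : AnchorMap n F V) (X : Sec n F V) (f : SmoothFun n M) (x : M) :
    ρ.act X f x = mfderiv (𝓡 n) 𝓘(ℝ, ℝ) f x (ρ.toFun x (X x)) := rfl

theorem AnchorMap.act_add (ρ : AnchorMap n F V) (X : Sec n F V) (f g : SmoothFun n M) :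
    ρ.act X (f + g) = ρ.act X f + ρ.act X g := by
  ext x
  have hf : MDifferentiableAt (𝓡 n) 𝓘(ℝ, ℝ) f x := f.mdifferentiableAt
  have hg : MDifferentiableAt (𝓡 n) 𝓘(ℝ, ℝ) g x := g.mdifferentiableAt
  change mfderiv (𝓡 n) 𝓘(ℝ, ℝ) ((f : M → ℝ) + (g : M → ℝ)) x _ = _
  rw [mfderiv_add hf hg]
  rfl

theorem AnchorMap.act_mul (ρ : AnchorMap n F V) (X : Sec n F V) (f g : SmoothFun n M) :
    ρ.act X (f * g) = f * ρ.act X g + ρ.act X f * g := by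
  ext x
  have hf : MDifferentiableAt (𝓡 n) 𝓘(ℝ, ℝ) f x := f.mdifferentiableAt
  have hg : MDifferentiableAt (𝓡 n) 𝓘(ℝ, ℝ) g x := g.mdifferentiableAt
  change mfderiv (𝓡 n) 𝓘(ℝ, ℝ) ((f : M → ℝ) * (g : M → ℝ)) x _ = _
  rw [(hf.hasMFDerivAt.mul hg.hasMFDerivAt).mfderiv]
  change f x * ρ.act X g x + g x * ρ.act X f x = f x * ρ.act X g x + ρ.act X f x * g x
  ring

variable [VectorBundle ℝ F V]

theorem AnchorMap.add_act (ρ : AnchorMap n F V) (X Y : Sec n F V) (f : SmoothFun n M) :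
    ρ.act (X + Y) f = ρ.act X f + ρ.act Y f := by
  ext x
  change mfderiv (𝓡 n) 𝓘(ℝ, ℝ) f x (ρ.toFun x (X x + Y x)) = _
  rw [map_add, map_add]
  rfl

theorem AnchorMap.smul_act (ρ : AnchorMap n F V) (g : SmoothFun n M) (X : Sec n F V)
    (f : SmoothFun n M) : ρ.act (g • X) f = g * ρ.act X f := by
  ext x
  change mfderiv (𝓡 n) 𝓘(ℝ, ℝ) f x (ρ.toFun x (g x • X x)) = _
  rw [map_smul, map_smul]
  rfl

variable (n F V) in
/-- A Lie algebroid structure on the vector bundle `V`: an anchor `ρ : V → TM` and a Lie bracket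
on `Γ(V)` satisfying the Leibniz rule. (That `ρ` is a morphism of Lie algebras follows.) -/
structure LieAlgebroid where
  anchor : AnchorMap n F V
  bracket : Sec n F V →ₗ[ℝ] Sec n F V →ₗ[ℝ] Sec n F V
  bracket_self : ∀ X, bracket X X = 0
  jacobi : ∀ X Y Z, bracket X (bracket Y Z) = bracket (bracket X Y) Z + bracket Y (bracket X Z)
  leibniz : ∀ (X : Sec n F V) (f : SmoothFun n M) (Y : Sec n F V),
    bracket X (f • Y) = f • bracket X Y + anchor.act X f • Y

theorem LieAlgebroid.skew (L : LieAlgebroid n F V) (X Y : Sec n F V) :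
    L.bracket X Y = - L.bracket Y X := by
  have := L.bracket_self (X + Y)
  simp only [map_add, LinearMap.add_apply, L.bracket_self, zero_add, add_zero] at this
  exact eq_neg_of_add_eq_zero_right this

theorem LieAlgebroid.leibniz_left (L : LieAlgebroid n F V) (f : SmoothFun n M) (X Y : Sec n F V) :
    L.bracket (f • X) Y = f • L.bracket X Y - L.anchor.act Y f • X := by
  rw [L.skew, L.leibniz, L.skew Y X]
  simp only [smul_neg]
  abel

/-- The differential of `ξ ∈ Γ(V*)` in the complex of the Lie algebroid `V`:
`(d ξ)(X, Y) = ρ(X)·⟨ξ, Y⟩ - ρ(Y)·⟨ξ, X⟩ - ⟨ξ, [X, Y]⟩`. -/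
def LieAlgebroid.diff (L : LieAlgebroid n F V) (ξ : Sec n (F →L[ℝ] ℝ) (Dual V))
    (X Y : Sec n F V) : SmoothFun n M :=
  L.anchor.act X (pair ξ Y) - L.anchor.act Y (pair ξ X) - pair ξ (L.bracket X Y)

/-- The differential of `X ∈ Γ(V)` in the complex of a Lie algebroid structure on `V*`:
`(d X)(ξ, η) = ρ(ξ)·⟨η, X⟩ - ρ(η)·⟨ξ, X⟩ - ⟨[ξ, η], X⟩`. -/
def LieAlgebroid.codiff (L : LieAlgebroid n (F →L[ℝ] ℝ) (Dual V)) (X : Sec n F V)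
    (ξ η : Sec n (F →L[ℝ] ℝ) (Dual V)) : SmoothFun n M :=
  L.anchor.act ξ (pair η X) - L.anchor.act η (pair ξ X) - pair (L.bracket ξ η) X

variable [FiniteDimensional ℝ F] [ContMDiffVectorBundle ∞ F V (𝓡 n)] [T2Space M]

/-- The Lie derivative `L_X ξ ∈ Γ(V*)` of `ξ ∈ Γ(V*)` along `X ∈ Γ(V)`:
`⟨L_X ξ, Y⟩ = ρ(X)·⟨ξ, Y⟩ - ⟨ξ, [X, Y]⟩`. -/
def LieAlgebroid.lieDeriv (L : LieAlgebroid n F V) (X : Sec n F V)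
    (ξ : Sec n (F →L[ℝ] ℝ) (Dual V)) : Sec n (F →L[ℝ] ℝ) (Dual V) :=
  toDual
    { toFun := fun Y => L.anchor.act X (pair ξ Y) - pair ξ (L.bracket X Y)
      map_add' := fun Y Z => by
        rw [pair_add_right, AnchorMap.act_add, map_add, pair_add_right]; ring
      map_smul' := fun f Y => by
        rw [pair_smul_right, AnchorMap.act_mul, L.leibniz, pair_add_right, pair_smul_right,
          pair_smul_right]
        simp only [RingHom.id_apply, smul_eq_mul]
        ring }

/-- The interior product `i_Y d ξ ∈ Γ(V*)`: `⟨i_Y d ξ, Z⟩ = (d ξ)(Y, Z)`. -/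
def LieAlgebroid.contrDiff (L : LieAlgebroid n F V) (Y : Sec n F V)
    (ξ : Sec n (F →L[ℝ] ℝ) (Dual V)) : Sec n (F →L[ℝ] ℝ) (Dual V) :=
  toDual
    { toFun := fun Z => L.diff ξ Y Z
      map_add' := fun Z W => by
        simp only [LieAlgebroid.diff]
        rw [pair_add_right, AnchorMap.act_add, AnchorMap.add_act, map_add, pair_add_right]; ring
      map_smul' := fun f Z => by
        simp only [LieAlgebroid.diff]
        rw [pair_smul_right, AnchorMap.act_mul, AnchorMap.smul_act, L.leibniz, pair_add_right,
          pair_smul_right, pair_smul_right]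
        simp only [RingHom.id_apply, smul_eq_mul]
        ring }

/-- The Lie derivative `L_ξ Y ∈ Γ(V)` of `Y ∈ Γ(V)` along `ξ ∈ Γ(V*)`, for a Lie algebroid
structure on `V*`: `⟨ζ, L_ξ Y⟩ = ρ(ξ)·⟨ζ, Y⟩ - ⟨[ξ, ζ], Y⟩`. -/
def LieAlgebroid.coLieDeriv (L : LieAlgebroid n (F →L[ℝ] ℝ) (Dual V))
    (ξ : Sec n (F →L[ℝ] ℝ) (Dual V)) (Y : Sec n F V) : Sec n F V :=
  toSec
    { toFun := fun ζ => L.anchor.act ξ (pair ζ Y) - pair (L.bracket ξ ζ) Y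
      map_add' := fun ζ η => by
        rw [pair_add_left, AnchorMap.act_add, map_add, pair_add_left]; ring
      map_smul' := fun f ζ => by
        rw [pair_smul_left, AnchorMap.act_mul, L.leibniz, pair_add_left, pair_smul_left,
          pair_smul_left]
        simp only [RingHom.id_apply, smul_eq_mul]
        ring }

/-- The interior product `i_η d X ∈ Γ(V)`, for a Lie algebroid structure on `V*`:
`⟨ζ, i_η d X⟩ = (d X)(η, ζ)`. -/
def LieAlgebroid.coContrDiff (L : LieAlgebroid n (F →L[ℝ] ℝ) (Dual V))
    (η : Sec n (F →L[ℝ] ℝ) (Dual V)) (X : Sec n F V) : Sec n F V :=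
  toSec
    { toFun := fun ζ => L.codiff X η ζ
      map_add' := fun ζ θ => by
        simp only [LieAlgebroid.codiff]
        rw [pair_add_left, AnchorMap.act_add, AnchorMap.add_act, map_add, pair_add_left]; ring
      map_smul' := fun f ζ => by
        simp only [LieAlgebroid.codiff]
        rw [pair_smul_left, AnchorMap.act_mul, AnchorMap.smul_act, L.leibniz, pair_add_left,
          pair_smul_left, pair_smul_left]
        simp only [RingHom.id_apply, smul_eq_mul]
        ring }

/-- The Lie derivative along `X ∈ Γ(V)` of a `C^∞(M)`-valued bilinear form `P` on `Γ(V*)`, in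
particular of a bivector field:
`(L_X P)(ξ, η) = ρ(X)·P(ξ, η) - P(L_X ξ, η) - P(ξ, L_X η)`. -/
def LieAlgebroid.lieBivector (L : LieAlgebroid n F V) (X : Sec n F V)
    (P : Sec n (F →L[ℝ] ℝ) (Dual V) → Sec n (F →L[ℝ] ℝ) (Dual V) → SmoothFun n M)
    (ξ η : Sec n (F →L[ℝ] ℝ) (Dual V)) : SmoothFun n M :=
  L.anchor.act X (P ξ η) - P (L.lieDeriv X ξ) η - P ξ (L.lieDeriv X η)

variable (n F V) in
/-- A Lie bialgebroid `((V, μ), (V*, γ))`: Lie algebroid structures on `V` and `V*` such that the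
differential `d_γ` is a derivation of the (Schouten) bracket of `μ`,
`d_γ [X, Y] = [d_γ X, Y] + [X, d_γ Y] = L_X (d_γ Y) - L_Y (d_γ X)`. -/
structure LieBialgebroid where
  μ : LieAlgebroid n F V
  γ : LieAlgebroid n (F →L[ℝ] ℝ) (Dual V)
  compatible : ∀ (X Y : Sec n F V) (ξ η : Sec n (F →L[ℝ] ℝ) (Dual V)),
    γ.codiff (μ.bracket X Y) ξ η =
      μ.lieBivector X (γ.codiff Y) ξ η - μ.lieBivector Y (γ.codiff X) ξ η

/-- The canonical fibrewise symmetric bilinear form on `V ⊕ V*`: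
`⟨v + α, w + β⟩ = α(w) + β(v)`. -/
def canonicalPairing (x : M) (u w : (V ×ᵇ Dual V) x) : ℝ := ev u.2 w.1 + ev w.2 u.1

/-- The Dorfman bracket of the double `V ⊕ V*` of a Lie bialgebroid: the bi-additive bracket with
`[X, Y] = [X, Y]^μ`, `[ξ, η] = [ξ, η]^γ`, `[X, η] = - i_η d_γ X + L^μ_X η` and
`[ξ, Y] = L^γ_ξ Y - i_Y d_μ ξ`. -/
def LieBialgebroid.dorfman (L : LieBialgebroid n F V)
    (u w : Sec n (F × (F →L[ℝ] ℝ)) (V ×ᵇ Dual V)) : Sec n (F × (F →L[ℝ] ℝ)) (V ×ᵇ Dual V) :=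
  mkSec
    (L.μ.bracket (vecPart u) (vecPart w) + L.γ.coLieDeriv (formPart u) (vecPart w)
      - L.γ.coContrDiff (formPart w) (vecPart u))
    (L.γ.bracket (formPart u) (formPart w) + L.μ.lieDeriv (vecPart u) (formPart w)
      - L.μ.contrDiff (vecPart w) (formPart u))

/-- The skew-symmetric endomorphism `diag(N, -ᵗN)` of `V ⊕ V*`. -/
def BundleHom.double (N : BundleEnd n F V) : BundleEnd n (F × (F →L[ℝ] ℝ)) (V ×ᵇ Dual V) where
  toFun x := (N.toFun x).prodMap (-(fibreTranspose (N.toFun x)))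
  smooth := smooth_of_sections (fun x => (N.toFun x).prodMap (-(fibreTranspose (N.toFun x))))
    fun u => (mkSec (N.map (vecPart u)) (-(N.transpose.map (formPart u)))).contMDiff

end LieAlgebroid

section Nijenhuis

variable {n : ℕ} {M : Type*} [TopologicalSpace M] [ChartedSpace (EuclideanSpace ℝ (Fin n)) M]
  {F : Type*} [NormedAddCommGroup F] [NormedSpace ℝ F]
  {V : M → Type*} [TopologicalSpace (TotalSpace F V)] [∀ x, TopologicalSpace (V x)]
  [FiberBundle F V] [∀ x, AddCommGroup (V x)] [∀ x, Module ℝ (V x)] [VectorBundle ℝ F V]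

/-- The Nijenhuis torsion of a vector bundle endomorphism `N` with respect to a bracket on `Γ(V)`:
`T(u, v) = [N u, N v] - N ([N u, v] + [u, N v] - N [u, v])`. -/
def torsion (br : Sec n F V → Sec n F V → Sec n F V) (N : BundleEnd n F V) (u v : Sec n F V) :
    Sec n F V :=
  br (N.map u) (N.map v) - N.map (br (N.map u) v + br u (N.map v) - N.map (br u v))

/-- A Nijenhuis tensor on a Courant algebroid with bilinear form `g` and Dorfman bracket `br`: an
endomorphism which is skew-symmetric for `g` and whose torsion vanishes. -/
def IsNijenhuisTensor (g : ∀ x, V x → V x → ℝ) (br : Sec n F V → Sec n F V → Sec n F V)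
    (N : BundleEnd n F V) : Prop :=
  (∀ x (u v : V x), g x (N.toFun x u) v + g x u (N.toFun x v) = 0) ∧
    ∀ u v : Sec n F V, torsion br N u v = 0

/-- Irreducibility of a Courant algebroid with bilinear form `g` and Dorfman bracket `br`: each
symmetric endomorphism `φ` with `[u, φ v] = φ [u, v]` and `[φ u, v] = φ [u, v]` for all sections
`u`, `v` is a constant multiple of the identity. -/
def IsIrreducible (g : ∀ x, V x → V x → ℝ) (br : Sec n F V → Sec n F V → Sec n F V) : Prop :=
  ∀ φ : BundleEnd n F V,
    (∀ x (u v : V x), g x (φ.toFun x u) v = g x u (φ.toFun x v)) →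
    (∀ u v : Sec n F V, br u (φ.map v) = φ.map (br u v) ∧ br (φ.map u) v = φ.map (br u v)) →
    ∃ c : ℝ, ∀ x (v : V x), φ.toFun x v = c • v

/-- A cps (complex, paracomplex or subtangent) structure on a Lie algebroid: an endomorphism `J`
with `J² = ε Id`, `ε ∈ {-1, 1, 0}`, and vanishing Nijenhuis torsion. -/
def LieAlgebroid.IsCps [IsManifold (𝓡 n) ∞ M] (L : LieAlgebroid n F V) (J : BundleEnd n F V) :
    Prop :=
  (∃ ε : ℝ, (ε = -1 ∨ ε = 1 ∨ ε = 0) ∧ ∀ x (v : V x), J.toFun x (J.toFun x v) = ε • v) ∧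
    ∀ X Y : Sec n F V, torsion (fun X Y => L.bracket X Y) J X Y = 0

/-- `N` is a constant multiple of a cps structure. -/
def LieAlgebroid.IsProportionalToCps [IsManifold (𝓡 n) ∞ M] (L : LieAlgebroid n F V)
    (N : BundleEnd n F V) : Prop :=
  ∃ (κ : ℝ) (J : BundleEnd n F V), L.IsCps J ∧ ∀ x (v : V x), N.toFun x v = κ • J.toFun x v

end Nijenhuis

end LieBialg

end

/-! The core is that the square of a Nijenhuis tensor T on the double commutes with the Dorfman
bracket in both slots (`sq_commutes_of_torsion_eq_zero`). Only two Courant identities enter: the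
bracket preserves the pairing, and its symmetric part is governed by the derivative of the pairing
along the anchor. Since T is skew, pairing the torsion equation with a third section gives a scalar
relation. Two instances of it, combined with invariance of the pairing, cancel everything except [u,
T²v] = T²[u, v]. The symmetric part then carries this over to the first slot.

T² is also symmetric, so irreducibility makes it a constant c times the identity
(`LieBialgebroid.sq_eq_const_smul`). For the block-diagonal tensor this says N² = c and (ᵗN)² = c.

The Dorfman bracket restricts to the two Lie algebroid brackets on A and A*, so N and -ᵗN are
torsion-free there; torsion is quadratic, so the sign does not matter. Dividing by √|c| when c ≠ 0
turns a torsion-free endomorphism of square c into a cps structure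
(`LieAlgebroid.isProportionalToCps_of_sq`). -/

namespace LieBialg

/-! ### Algebra of metric brackets. -/

/-- If `T` is skew-symmetric with vanishing torsion for a metric bracket `br` whose symmetric part
is `⟨br u v + br v u, w⟩ = ρ(w)·⟨u, v⟩`, then `T²` commutes with `br` in both arguments. -/
theorem sq_commutes_of_torsion_eq_zero {S R : Type*} [AddCommGroup S] [CommRing R]
    (B : S → S → R) (act : S → R → R) (br : S → S → S) (T : S → S)
    (B_add : ∀ u v w, B (u + v) w = B u w + B v w) (B_symm : ∀ u v, B u v = B v u)
    (B_ext : ∀ u v, (∀ w, B u w = B v w) → u = v)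
    (act_neg : ∀ u f, act u (-f) = -act u f)
    (metric : ∀ u v w, act u (B v w) = B (br u v) w + B v (br u w))
    (symm_part : ∀ u v w, B (br u v) w + B (br v u) w = act w (B u v))
    (T_skew : ∀ u v, B (T u) v = -B u (T v))
    (T_torsion : ∀ u v, br (T u) (T v) = T (br (T u) v + br u (T v) - T (br u v))) (u v : S) :
    br u (T (T v)) = T (T (br u v)) ∧ br (T (T u)) v = T (T (br u v)) := by
  have B_sub : ∀ u v w, B (u - v) w = B u w - B v w := fun u v w => by
    have := B_add (u - v) v w
    rw [sub_add_cancel] at this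
    rw [this, add_sub_cancel_right]
  have T_sq : ∀ u v, B (T (T u)) v = B u (T (T v)) := fun u v => by
    rw [T_skew, T_skew, neg_neg]
  have torsion_pairing : ∀ u v w, B (br (T u) (T v)) w
      = -B (br (T u) v) (T w) - B (br u (T v)) (T w) - B (br u v) (T (T w)) := fun u v w => by
    rw [T_torsion, T_skew, B_sub, B_add, T_skew]
    ring
  have right : ∀ u v, br u (T (T v)) = T (T (br u v)) := fun u v => B_ext _ _ fun w => by
    -- By skewness of `T`, the derivative terms of `h1` and `h2` are opposite, as are those of `h3`
    -- and `h4`. Of the eight bracket terms left in the sum, the two torsion relations remove all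
    -- but the two in the goal.
    have h1 := metric (T u) (T w) v
    have h2 := metric (T u) w (T v)
    have h3 := metric u (T w) (T v)
    have h4 := metric u w (T (T v))
    rw [T_skew, act_neg, B_symm (T w)] at h1
    rw [T_skew, act_neg, B_symm (T w)] at h3
    rw [B_symm w (br _ _)] at h2 h4
    rw [T_sq]
    linear_combination -h1 - h2 - h3 - h4 - torsion_pairing u w v - torsion_pairing u v w
  -- Symmetrizing the torsion relation in `u` and `v` leaves only derivatives of pairings. Those
  -- along `T w` cancel because B(Tu, v) + B(u, Tv) = 0.
  have act_sq : ∀ u v w, act (T (T w)) (B u v) = act w (B (T (T u)) v) := fun u v w => by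
    have h1 := symm_part (T u) (T v) w
    have h2 := symm_part (T u) v (T w)
    have h3 := symm_part u (T v) (T w)
    have e : B (T u) (T v) = -B (T (T u)) v := by rw [T_skew (T u), neg_neg]
    rw [e, act_neg] at h1
    rw [T_skew, act_neg] at h2
    linear_combination -h1 - h2 - h3 - symm_part u v (T (T w)) + torsion_pairing u v w
      + torsion_pairing v u w
  refine ⟨right u v, B_ext _ _ fun w => ?_⟩
  -- The symmetric part exchanges the two slots: `right` handles `br v (T (T u))`, `act_sq` rewrites
  -- the derivative, and the terms in `br v u` cancel.
  have h1 := symm_part (T (T u)) v w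
  rw [right, T_sq, ← act_sq, ← symm_part] at h1
  rw [T_sq]
  exact add_right_cancel h1

section

variable {n : ℕ} {M : Type*} [TopologicalSpace M] [ChartedSpace (EuclideanSpace ℝ (Fin n)) M]
  {F : Type*} [NormedAddCommGroup F] [NormedSpace ℝ F]
  {V : M → Type*} [TopologicalSpace (TotalSpace F V)] [∀ x, TopologicalSpace (V x)]
  [FiberBundle F V] [∀ x, AddCommGroup (V x)] [∀ x, Module ℝ (V x)]

/-! ### Induced maps on sections and nondegeneracy of the duality pairing. -/

/-- The composition of two vector bundle endomorphisms. -/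
def BundleHom.comp (φ ψ : BundleEnd n F V) : BundleEnd n F V where
  toFun x := (φ.toFun x).comp (ψ.toFun x)
  smooth := φ.smooth.comp ψ.smooth

variable [VectorBundle ℝ F V]

theorem BundleHom.map_neg (φ : BundleEnd n F V) (X : Sec n F V) : φ.map (-X) = -φ.map X := by
  ext x; exact _root_.map_neg (φ.toFun x) _

theorem BundleHom.map_add (φ : BundleEnd n F V) (X Y : Sec n F V) :
    φ.map (X + Y) = φ.map X + φ.map Y := by
  ext x; exact _root_.map_add (φ.toFun x) _ _

theorem BundleHom.map_sub (φ : BundleEnd n F V) (X Y : Sec n F V) :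
    φ.map (X - Y) = φ.map X - φ.map Y := by
  ext x; exact _root_.map_sub (φ.toFun x) _ _

theorem BundleHom.map_smul (φ : BundleEnd n F V) (c : ℝ) (X : Sec n F V) :
    φ.map (c • X) = c • φ.map X := by
  ext x; exact _root_.map_smul (φ.toFun x) c _

variable [IsManifold (𝓡 n) ∞ M] [FiniteDimensional ℝ F] [ContMDiffVectorBundle ∞ F V (𝓡 n)]
  [T2Space M]

theorem pair_neg_left (ξ : Sec n (F →L[ℝ] ℝ) (Dual V)) (X : Sec n F V) :
    pair (-ξ) X = -pair ξ X := by ext x; exact neg_ev _ _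

theorem pair_sub_left (ξ η : Sec n (F →L[ℝ] ℝ) (Dual V)) (X : Sec n F V) :
    pair (ξ - η) X = pair ξ X - pair η X := by
  rw [sub_eq_add_neg, pair_add_left, pair_neg_left, sub_eq_add_neg]

theorem pair_neg_right (ξ : Sec n (F →L[ℝ] ℝ) (Dual V)) (X : Sec n F V) :
    pair ξ (-X) = -pair ξ X := by ext x; exact ev_neg _ _

theorem pair_sub_right (ξ : Sec n (F →L[ℝ] ℝ) (Dual V)) (X Y : Sec n F V) :
    pair ξ (X - Y) = pair ξ X - pair ξ Y := by
  rw [sub_eq_add_neg, pair_add_right, pair_neg_right, sub_eq_add_neg]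

theorem pair_zero_left (X : Sec n F V) : pair (0 : Sec n (F →L[ℝ] ℝ) (Dual V)) X = 0 := by
  ext x; exact zero_ev _

theorem pair_zero_right (ξ : Sec n (F →L[ℝ] ℝ) (Dual V)) : pair ξ (0 : Sec n F V) = 0 := by
  ext x; exact ev_zero _

theorem dual_sec_ext {ξ η : Sec n (F →L[ℝ] ℝ) (Dual V)} (h : ∀ X, pair ξ X = pair η X) :
    ξ = η := by
  ext x : 1
  refine ev_ext fun v => ?_
  obtain ⟨X, rfl⟩ := exists_sec_eq (n := n) (F := F) x v
  exact congrArg (fun f : SmoothFun n M => f x) (h X)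

/-- At a point where the cutoff of the local frame equals 1, the global dual sections `θ i` read off
all coordinates of a vector. -/
theorem sec_ext {X Y : Sec n F V}
    (h : ∀ ξ : Sec n (F →L[ℝ] ℝ) (Dual V), pair ξ X = pair ξ Y) : X = Y := by
  ext x : 1
  obtain ⟨k, E, θ, f, hf, hE⟩ := exists_local_frame (n := n) (F := F) (V := V) x
  have e1 := hE x (X x)
  have e2 := hE x (Y x)
  rw [hf.self_of_nhds, one_smul] at e1 e2
  rw [e1]
  refine Eq.trans (Finset.sum_congr rfl fun i _ => ?_) e2.symm
  rw [← pair_apply, h, pair_apply]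

theorem AnchorMap.zero_act (ρ : AnchorMap n F V) (f : SmoothFun n M) : ρ.act 0 f = 0 := by
  have := ρ.add_act 0 0 f
  rwa [add_zero, left_eq_add] at this

theorem AnchorMap.act_zero (ρ : AnchorMap n F V) (X : Sec n F V) : ρ.act X 0 = 0 := by
  have := ρ.act_add X 0 0
  rwa [add_zero, left_eq_add] at this

theorem AnchorMap.act_neg (ρ : AnchorMap n F V) (X : Sec n F V) (f : SmoothFun n M) :
    ρ.act X (-f) = -ρ.act X f := by
  have := ρ.act_add X (-f) f
  rw [neg_add_cancel, ρ.act_zero] at this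
  exact eq_neg_of_add_eq_zero_left this.symm

/-! ### Rescaling to a cps structure. -/

/-- The multiple of a vector bundle endomorphism by a constant, on the fibre at `x`. -/
noncomputable def BundleHom.fibreConstSMul (c : ℝ) (N : BundleEnd n F V) (x : M) :
    V x →L[ℝ] V x where
  toLinearMap := c • (N.toFun x).toLinearMap
  -- The hypotheses give a fibre only a topology and a module structure, so continuity of scaling is
  -- transported from the model space `F` through a trivialization.
  cont := by
    let e := (trivializationAt F V x).continuousLinearEquivAt ℝ x
      (mem_baseSet_trivializationAt F V x)
    have h : ⇑(c • (N.toFun x).toLinearMap) = fun v => e.symm (c • e (N.toFun x v)) :=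
      funext fun v => by
        rw [_root_.map_smul, e.symm_apply_apply]
        rfl
    exact (congrArg Continuous h).mpr
      (e.symm.continuous.comp ((e.continuous.comp (N.toFun x).continuous).const_smul c))

/-- The multiple of a vector bundle endomorphism by a constant. -/
noncomputable def BundleHom.constSMul (c : ℝ) (N : BundleEnd n F V) : BundleEnd n F V where
  toFun := N.fibreConstSMul c
  smooth := smooth_of_sections (N.fibreConstSMul c) fun X => (c • N.map X).contMDiff

theorem BundleHom.constSMul_toFun (c : ℝ) (N : BundleEnd n F V) (x : M) (v : V x) :
    (N.constSMul c).toFun x v = c • N.toFun x v := rfl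

theorem BundleHom.constSMul_map (c : ℝ) (N : BundleEnd n F V) (X : Sec n F V) :
    (N.constSMul c).map X = c • N.map X := rfl

/-- Each term of the torsion contains the endomorphism exactly twice, and a constant passes through
the ℝ-bilinear bracket. -/
theorem LieAlgebroid.torsion_constSMul (L : LieAlgebroid n F V) (c : ℝ) (N : BundleEnd n F V)
    (X Y : Sec n F V) :
    torsion (fun X Y => L.bracket X Y) (N.constSMul c) X Y
      = (c * c) • torsion (fun X Y => L.bracket X Y) N X Y := by
  simp only [torsion, BundleHom.constSMul_map, _root_.map_smul, LinearMap.smul_apply,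
    BundleHom.map_add, BundleHom.map_sub, BundleHom.map_smul, smul_add, smul_sub, smul_smul]

/-- A torsion-free endomorphism whose square is a constant multiple of the identity is a constant
multiple of a cps structure. -/
theorem LieAlgebroid.isProportionalToCps_of_sq (L : LieAlgebroid n F V) (N : BundleEnd n F V)
    (c : ℝ) (hc : ∀ x (v : V x), N.toFun x (N.toFun x v) = c • v)
    (hT : ∀ X Y : Sec n F V, torsion (fun X Y => L.bracket X Y) N X Y = 0) :
    L.IsProportionalToCps N := by
  by_cases h0 : c = 0
  · exact ⟨1, N, ⟨⟨0, .inr (.inr rfl), fun x v => by rw [hc, h0]⟩, hT⟩,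
      fun x v => (one_smul ℝ _).symm⟩
  -- Dividing N by √|c| replaces the square c by its sign c / |c|, which is ±1.
  have hs : √|c| ≠ 0 := (Real.sqrt_pos.2 (abs_pos.2 h0)).ne'
  refine ⟨√|c|, N.constSMul (√|c|)⁻¹, ⟨⟨c / |c|, ?_, fun x v => ?_⟩, fun X Y => ?_⟩,
    fun x v => ?_⟩
  · rcases lt_or_gt_of_ne h0 with h | h
    · left; rw [abs_of_neg h, div_neg, div_self h0]
    · right; left; rw [abs_of_pos h, div_self h0]
  · rw [BundleHom.constSMul_toFun, BundleHom.constSMul_toFun, _root_.map_smul, hc, smul_smul,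
      smul_smul, ← mul_inv, Real.mul_self_sqrt (abs_nonneg c), inv_mul_eq_div]
  · rw [L.torsion_constSMul, hT, smul_zero]
  · rw [BundleHom.constSMul_toFun, smul_smul, mul_inv_cancel₀ hs, one_smul]

/-! ### Courant algebroid identities of the double. -/

/-- The canonical pairing of two sections of `V ⊕ V*`. -/
noncomputable def sectionPairing (u w : Sec n (F × (F →L[ℝ] ℝ)) (V ×ᵇ Dual V)) : SmoothFun n M :=
  pair (formPart u) (vecPart w) + pair (formPart w) (vecPart u)

theorem sectionPairing_symm (u w : Sec n (F × (F →L[ℝ] ℝ)) (V ×ᵇ Dual V)) :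
    sectionPairing u w = sectionPairing w u := add_comm _ _

theorem sectionPairing_add (u v w : Sec n (F × (F →L[ℝ] ℝ)) (V ×ᵇ Dual V)) :
    sectionPairing (u + v) w = sectionPairing u w + sectionPairing v w := by
  have h1 : formPart (u + v) = formPart u + formPart v := rfl
  have h2 : vecPart (u + v) = vecPart u + vecPart v := rfl
  simp only [sectionPairing, h1, h2, pair_add_left, pair_add_right]
  ring

/-- Pure sections (0, ξ) and (X, 0) test the two components separately. -/
theorem sectionPairing_ext (u v : Sec n (F × (F →L[ℝ] ℝ)) (V ×ᵇ Dual V))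
    (h : ∀ w, sectionPairing u w = sectionPairing v w) : u = v := by
  have h1 : vecPart u = vecPart v := sec_ext fun ξ => by
    have := h (mkSec 0 ξ)
    change pair _ 0 + pair ξ _ = pair _ 0 + pair ξ _ at this
    rwa [pair_zero_right, pair_zero_right, zero_add, zero_add] at this
  have h2 : formPart u = formPart v := dual_sec_ext fun X => by
    have := h (mkSec X 0)
    change pair _ X + pair 0 _ = pair _ X + pair 0 _ at this
    rwa [pair_zero_left, pair_zero_left, add_zero, add_zero] at this
  ext x : 1
  exact Prod.ext (congrArg (fun s : Sec n F V => s x) h1)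
    (congrArg (fun s : Sec n (F →L[ℝ] ℝ) (Dual V) => s x) h2)

/-- The derivation of functions along the anchor of the double. -/
noncomputable def LieBialgebroid.act (L : LieBialgebroid n F V)
    (u : Sec n (F × (F →L[ℝ] ℝ)) (V ×ᵇ Dual V)) (f : SmoothFun n M) : SmoothFun n M :=
  L.μ.anchor.act (vecPart u) f + L.γ.anchor.act (formPart u) f

theorem LieBialgebroid.act_neg (L : LieBialgebroid n F V)
    (u : Sec n (F × (F →L[ℝ] ℝ)) (V ×ᵇ Dual V)) (f : SmoothFun n M) :
    L.act u (-f) = -L.act u f := by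
  simp only [LieBialgebroid.act, AnchorMap.act_neg]
  ring

/-- Unwinding the Lie derivatives and contractions into anchors, brackets and pairings reduces the
Courant identities to commutative algebra in C^∞(M). -/
theorem LieBialgebroid.sectionPairing_dorfman (L : LieBialgebroid n F V)
    (u v w : Sec n (F × (F →L[ℝ] ℝ)) (V ×ᵇ Dual V)) :
    sectionPairing (L.dorfman u v) w
      = pair (L.γ.bracket (formPart u) (formPart v)) (vecPart w)
        + (L.μ.anchor.act (vecPart u) (pair (formPart v) (vecPart w))
            - pair (formPart v) (L.μ.bracket (vecPart u) (vecPart w)))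
        - L.μ.diff (formPart u) (vecPart v) (vecPart w)
        + (pair (formPart w) (L.μ.bracket (vecPart u) (vecPart v))
          + (L.γ.anchor.act (formPart u) (pair (formPart w) (vecPart v))
            - pair (L.γ.bracket (formPart u) (formPart w)) (vecPart v))
          - L.γ.codiff (vecPart u) (formPart v) (formPart w)) := by
  change pair (_ + LieAlgebroid.lieDeriv _ _ _ - LieAlgebroid.contrDiff _ _ _) (vecPart w)
    + pair (formPart w) (_ + LieAlgebroid.coLieDeriv _ _ _ - LieAlgebroid.coContrDiff _ _ _) = _
  rw [pair_sub_left, pair_add_left, pair_sub_right, pair_add_right]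
  unfold LieAlgebroid.lieDeriv LieAlgebroid.contrDiff LieAlgebroid.coLieDeriv
    LieAlgebroid.coContrDiff
  rw [pair_toDual, pair_toDual, pair_toSec, pair_toSec]
  rfl

/-- The Lie derivatives contribute the derivative along the anchor and their bracket terms cancel;
the contributions of dξ and dX drop out because these are alternating. -/
theorem LieBialgebroid.act_sectionPairing (L : LieBialgebroid n F V)
    (u v w : Sec n (F × (F →L[ℝ] ℝ)) (V ×ᵇ Dual V)) :
    L.act u (sectionPairing v w)
      = sectionPairing (L.dorfman u v) w + sectionPairing v (L.dorfman u w) := by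
  rw [sectionPairing_symm v (L.dorfman u w), L.sectionPairing_dorfman, L.sectionPairing_dorfman]
  simp only [LieBialgebroid.act, sectionPairing, LieAlgebroid.diff, LieAlgebroid.codiff,
    AnchorMap.act_add]
  rw [L.μ.skew (vecPart w) (vecPart v), L.γ.skew (formPart w) (formPart v), pair_neg_left,
    pair_neg_right]
  ring

/-- The two Lie brackets are skew and cancel. What remains is Cartan's formula, L_X η - i_X dη =
d⟨η, X⟩, together with its counterpart for γ. -/
theorem LieBialgebroid.sectionPairing_dorfman_add_swap (L : LieBialgebroid n F V)
    (u v w : Sec n (F × (F →L[ℝ] ℝ)) (V ×ᵇ Dual V)) :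
    sectionPairing (L.dorfman u v) w + sectionPairing (L.dorfman v u) w
      = L.act w (sectionPairing u v) := by
  rw [L.sectionPairing_dorfman, L.sectionPairing_dorfman]
  simp only [LieBialgebroid.act, sectionPairing, LieAlgebroid.diff, LieAlgebroid.codiff,
    AnchorMap.act_add]
  rw [L.μ.skew (vecPart v) (vecPart u), L.γ.skew (formPart v) (formPart u), pair_neg_left,
    pair_neg_right]
  ring

/-- The square of a Nijenhuis tensor on the double of an irreducible Lie bialgebroid is a constant
multiple of the identity. -/
theorem LieBialgebroid.sq_eq_const_smul (L : LieBialgebroid n F V)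
    (hirr : IsIrreducible canonicalPairing L.dorfman)
    (T : BundleEnd n (F × (F →L[ℝ] ℝ)) (V ×ᵇ Dual V))
    (hT : IsNijenhuisTensor canonicalPairing L.dorfman T) :
    ∃ c : ℝ, ∀ x (v : (V ×ᵇ Dual V) x), T.toFun x (T.toFun x v) = c • v := by
  obtain ⟨skew, tors⟩ := hT
  -- T² is symmetric because moving each of the two factors across the pairing costs one sign.
  refine hirr (T.comp T) (fun x u v => ?_) fun u v => ?_
  · change canonicalPairing x (T.toFun x (T.toFun x u)) v
      = canonicalPairing x u (T.toFun x (T.toFun x v))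
    linear_combination skew x (T.toFun x u) v - skew x u (T.toFun x v)
  · exact sq_commutes_of_torsion_eq_zero sectionPairing L.act L.dorfman T.map
      sectionPairing_add sectionPairing_symm sectionPairing_ext L.act_neg L.act_sectionPairing
      L.sectionPairing_dorfman_add_swap
      (fun u v => by ext x; exact eq_neg_of_add_eq_zero_left (skew x (u x) (v x)))
      (fun u v => sub_eq_zero.1 (tors u v)) u v

/-! ### Restriction of the double to A and to A*. -/

theorem LieAlgebroid.coLieDeriv_zero (L : LieAlgebroid n (F →L[ℝ] ℝ) (Dual V)) (Y : Sec n F V) :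
    L.coLieDeriv 0 Y = 0 := sec_ext fun ζ => by
  unfold LieAlgebroid.coLieDeriv
  rw [pair_toSec]
  change L.anchor.act 0 _ - pair (L.bracket 0 ζ) Y = _
  rw [AnchorMap.zero_act, _root_.map_zero, LinearMap.zero_apply, pair_zero_left,
    pair_zero_right, sub_zero]

theorem LieAlgebroid.coContrDiff_zero (L : LieAlgebroid n (F →L[ℝ] ℝ) (Dual V))
    (X : Sec n F V) : L.coContrDiff 0 X = 0 := sec_ext fun ζ => by
  unfold LieAlgebroid.coContrDiff
  rw [pair_toSec]
  change L.anchor.act 0 _ - L.anchor.act ζ (pair 0 X) - pair (L.bracket 0 ζ) X = _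
  rw [AnchorMap.zero_act, _root_.map_zero, LinearMap.zero_apply, pair_zero_left,
    pair_zero_right, AnchorMap.act_zero, sub_zero, sub_zero]

theorem LieAlgebroid.lieDeriv_zero (L : LieAlgebroid n F V)
    (ξ : Sec n (F →L[ℝ] ℝ) (Dual V)) : L.lieDeriv 0 ξ = 0 := dual_sec_ext fun Y => by
  unfold LieAlgebroid.lieDeriv
  rw [pair_toDual]
  change L.anchor.act 0 _ - pair ξ (L.bracket 0 Y) = _
  rw [AnchorMap.zero_act, _root_.map_zero, LinearMap.zero_apply, pair_zero_left,
    pair_zero_right, sub_zero]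

theorem LieAlgebroid.contrDiff_zero (L : LieAlgebroid n F V)
    (ξ : Sec n (F →L[ℝ] ℝ) (Dual V)) : L.contrDiff 0 ξ = 0 := dual_sec_ext fun Y => by
  unfold LieAlgebroid.contrDiff
  rw [pair_toDual]
  change L.anchor.act 0 _ - L.anchor.act Y (pair ξ 0) - pair ξ (L.bracket 0 Y) = _
  rw [AnchorMap.zero_act, _root_.map_zero, LinearMap.zero_apply, pair_zero_left,
    pair_zero_right, AnchorMap.act_zero, sub_zero, sub_zero]

/-- Purity is a hypothesis on components rather than the form `mkSec X 0`, so that it also applies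
to images under `N.double`, whose zero component is only provably zero. -/
theorem LieBialgebroid.vecPart_dorfman (L : LieBialgebroid n F V)
    (u v : Sec n (F × (F →L[ℝ] ℝ)) (V ×ᵇ Dual V)) (hu : formPart u = 0) (hv : formPart v = 0) :
    vecPart (L.dorfman u v) = L.μ.bracket (vecPart u) (vecPart v) := by
  change _ + LieAlgebroid.coLieDeriv _ (formPart u) _
    - LieAlgebroid.coContrDiff _ (formPart v) _ = _
  rw [hu, hv, LieAlgebroid.coLieDeriv_zero, LieAlgebroid.coContrDiff_zero, add_zero, sub_zero]

theorem LieBialgebroid.formPart_dorfman (L : LieBialgebroid n F V)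
    (u v : Sec n (F × (F →L[ℝ] ℝ)) (V ×ᵇ Dual V)) (hu : vecPart u = 0) (hv : vecPart v = 0) :
    formPart (L.dorfman u v) = L.γ.bracket (formPart u) (formPart v) := by
  change _ + LieAlgebroid.lieDeriv _ (vecPart u) _
    - LieAlgebroid.contrDiff _ (vecPart v) _ = _
  rw [hu, hv, LieAlgebroid.lieDeriv_zero, LieAlgebroid.contrDiff_zero, add_zero, sub_zero]

theorem LieBialgebroid.torsion_eq_zero_of_double (L : LieBialgebroid n F V)
    (N : BundleEnd n F V) (hN : ∀ u v, torsion L.dorfman N.double u v = 0) (X Y : Sec n F V) :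
    torsion (fun X Y => L.μ.bracket X Y) N X Y = 0 := by
  have hz : ∀ X : Sec n F V, formPart (N.double.map (mkSec X 0)) = 0 := fun X => by
    ext x : 1
    change -(N.transpose.toFun x 0) = 0
    rw [(N.transpose.toFun x).map_zero, neg_zero]
  have key := congrArg vecPart (hN (mkSec X 0) (mkSec Y 0))
  -- `N.double` is block diagonal, so taking the A-component turns it into `N` definitionally.
  change vecPart (L.dorfman (N.double.map (mkSec X 0)) (N.double.map (mkSec Y 0)))
    - N.map (vecPart (L.dorfman (N.double.map (mkSec X 0)) (mkSec Y 0))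
      + vecPart (L.dorfman (mkSec X 0) (N.double.map (mkSec Y 0)))
      - N.map (vecPart (L.dorfman (mkSec X 0) (mkSec Y 0)))) = 0 at key
  rwa [L.vecPart_dorfman _ _ (hz _) (hz _), L.vecPart_dorfman _ _ (hz _) rfl, L.vecPart_dorfman _ _ rfl (hz _),
    L.vecPart_dorfman _ _ rfl rfl] at key

theorem LieBialgebroid.torsion_transpose_eq_zero_of_double (L : LieBialgebroid n F V)
    (N : BundleEnd n F V) (hN : ∀ u v, torsion L.dorfman N.double u v = 0)
    (ξ η : Sec n (F →L[ℝ] ℝ) (Dual V)) :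
    torsion (fun ξ η => L.γ.bracket ξ η) N.transpose ξ η = 0 := by
  have hz : ∀ ξ : Sec n (F →L[ℝ] ℝ) (Dual V), vecPart (N.double.map (mkSec 0 ξ)) = 0 :=
    fun ξ => by ext x : 1; exact map_zero (N.toFun x)
  have key := congrArg formPart (hN (mkSec 0 ξ) (mkSec 0 η))
  change formPart (L.dorfman (N.double.map (mkSec 0 ξ)) (N.double.map (mkSec 0 η)))
    - -(N.transpose.map (formPart (L.dorfman (N.double.map (mkSec 0 ξ)) (mkSec 0 η))
      + formPart (L.dorfman (mkSec 0 ξ) (N.double.map (mkSec 0 η)))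
      - -(N.transpose.map (formPart (L.dorfman (mkSec 0 ξ) (mkSec 0 η)))))) = 0 at key
  rw [L.formPart_dorfman _ _ (hz _) (hz _), L.formPart_dorfman _ _ (hz _) rfl, L.formPart_dorfman _ _ rfl (hz _),
    L.formPart_dorfman _ _ rfl rfl] at key
  change L.γ.bracket (-(N.transpose.map ξ)) (-(N.transpose.map η))
    - -(N.transpose.map (L.γ.bracket (-(N.transpose.map ξ)) η
      + L.γ.bracket ξ (-(N.transpose.map η))
      - -(N.transpose.map (L.γ.bracket ξ η)))) = 0 at key
  -- `key` is the vanishing torsion of -ᵗN; the signs cancel in pairs since torsion is quadratic.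
  rw [← key]
  simp only [torsion, LinearMap.map_neg, LinearMap.neg_apply, BundleHom.map_add, BundleHom.map_sub,
    BundleHom.map_neg]
  abel

end

end LieBialg


/-! ### Conclusion for N and its transpose. -/

theorem theorem4p4 {n : ℕ} {M : Type*} [TopologicalSpace M]
    [ChartedSpace (EuclideanSpace ℝ (Fin n)) M] [IsManifold (𝓡 n) ∞ M] [T2Space M]
    {F : Type*} [NormedAddCommGroup F] [NormedSpace ℝ F] [FiniteDimensional ℝ F]
    {A : M → Type*} [TopologicalSpace (Bundle.TotalSpace F A)] [∀ x, TopologicalSpace (A x)]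
    [FiberBundle F A] [∀ x, AddCommGroup (A x)] [∀ x, Module ℝ (A x)] [VectorBundle ℝ F A]
    [ContMDiffVectorBundle ∞ F A (𝓡 n)]
    (L : LieBialg.LieBialgebroid n F A)
    (hirr : LieBialg.IsIrreducible LieBialg.canonicalPairing L.dorfman)
    (N : LieBialg.BundleEnd n F A)
    (hN : LieBialg.IsNijenhuisTensor LieBialg.canonicalPairing L.dorfman N.double) :
    L.μ.IsProportionalToCps N ∧ L.γ.IsProportionalToCps N.transpose := by
  obtain ⟨c, hc⟩ := L.sq_eq_const_smul hirr N.double hN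
  refine ⟨L.μ.isProportionalToCps_of_sq N c (fun x v => ?_) (L.torsion_eq_zero_of_double N hN.2),
    L.γ.isProportionalToCps_of_sq N.transpose c (fun x ξ => ?_)
      (L.torsion_transpose_eq_zero_of_double N hN.2)⟩
  -- Both squares are read off the same constant: on (v, 0) the square of `N.double` is N²v, and on
  -- (0, ξ) it is (-ᵗN)²ξ.
  · exact congrArg Prod.fst (hc x (v, 0))
  · have h : -(N.transpose.toFun x (-(N.transpose.toFun x ξ))) = c • ξ :=
      congrArg Prod.snd (hc x (0, ξ))
    rwa [(N.transpose.toFun x).map_neg, neg_neg] at h
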